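/- Let $K$ be a number field, let $V$ be the set of all places of $K$ with normalized absolute values $|\cdot|_v$ $(v\in V)$, and let $\mathrm{Arch}\subset V$ be the set of Archimedean places. Let $S$ be a set containing (copies of) $K$ and $\mathbb{R}$, and let $S\to{}^*S$ be a countably saturated nonstandard extension: every finitary function and relation on $S$ has an extension to ${}^*S$ so that the Transfer Principle holds for all first-order statements about them, and every sequence of internal (definable with parameters) subsets of ${}^*S$ with the finite intersection property has nonempty intersection. This gives a ring ${}^*K\supset K$, an ordered ring ${}^*\mathbb{R}\supset\mathbb{R}$ and maps $|\cdot|_v:{}^*K\to{}^*\mathbb{R}$ for $v\in V$. Endow ${}^*K$ with the uniform structure generated by the entourages $\{(x,y) : |x-y|_v<\varepsilon\}$ for $v\in V$ and standard real $\varepsilon>0$. Put $$\mathrm{fin}_V({}^*K)=\{x\in{}^*K : \text{for every } v\in V \text{ there is } r\in\mathbb{R} \text{ with } |x|_v<r\},$$ and, for finite $T\subset V$, $$\mathrm{fin}_{V,T}({}^*K)=\{x\in\mathrm{fin}_V({}^*K) : |x|_v\le 1 \text{ for all } v\in V\setminus(T\cup\mathrm{Arch})\}$$ with the subspace topology of ${}^*K$.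 Let $$\mathrm{fin}'_V({}^*K)=\varinjlim_T\mathrm{fin}_{V,T}({}^*K)=\bigcup_T\mathrm{fin}_{V,T}({}^*K)$$ carry the final topology with respect to the inclusions of the $\mathrm{fin}_{V,T}({}^*K)$, and let $$\mathrm{inf}_V({}^*K)=\{x\in{}^*K : |x|_v<\varepsilon \text{ for all } v\in V \text{ and all standard real } \varepsilon>0\}.$$ Let $A_K$ be the adele ring of $K$. Then $\mathrm{fin}'_V({}^*K)$ is a locally quasi-compact topological ring, and $\mathrm{inf}_V({}^*K)$ is an ideal of it and equals the closure of $\{0\}$. There is a continuous surjective ring homomorphism $\Phi:\mathrm{fin}'_V({}^*K)\to A_K$ with kernel $\mathrm{inf}_V({}^*K)$, which takes standard parts at all places: for $v\in V$, $k\in K$ and real $\varepsilon$, if $|\Phi(x)_v-k|_v<\varepsilon$ in $K_v$, then $|x-k|_v<\varepsilon$ in ${}^*\mathbb{R}$. It induces an isomorphism of topological rings $$\mathrm{fin}'_V({}^*K)/\mathrm{inf}_V({}^*K)\cong A_K .$$ Moreover $A_K$ is the Hausdorff topological ring associated with $\mathrm{fin}'_V({}^*K)$: $\Phi$ induces an isomorphism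 of topological rings from the maximal Hausdorff quotient of $\mathrm{fin}'_V({}^*K)$ onto $A_K$. -/

import Mathlib

universe u w

open scoped FirstOrder

noncomputable section

/-! ### Nonstandard extensions -/

/-- The language with a symbol for every finitary function and every finitary relation on `S`. -/
def fullLanguage (S : Type u) : FirstOrder.Language.{u, u} where
  Functions n := (Fin n → S) → S
  Relations n := Set (Fin n → S)

instance fullStructure (S : Type u) : (fullLanguage S).Structure S where
  funMap f x := f x
  RelMap {n} R x := (show Set (Fin n → S) from R) x

/-- A countably saturated nonstandard extension of the base set `S`: a structure `*S` in which every
finitary function and relation on `S` has an extension, together with an embedding `S → *S` that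
satisfies the Transfer Principle (it is elementary for the full language of `S`), such that every
sequence of internal subsets of `*S` (i.e. those defined by a formula with
parameters in `*S`) with the finite intersection property has nonempty intersection. -/
structure NonstandardExtension (S : Type u) where
  carrier : Type w
  [str : (fullLanguage S).Structure carrier]
  emb : S ↪ₑ[fullLanguage S] carrier
  countably_saturated : ∀ A : ℕ → Set carrier,
    (∀ n, (Set.univ : Set carrier).Definable₁ (fullLanguage S) (A n)) →
    (∀ n, (⋂ k ≤ n, A k).Nonempty) → (⋂ n, A n).Nonempty

namespace NonstandardExtension

attribute [instance] NonstandardExtension.str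

variable {S : Type u} (E : NonstandardExtension.{u, w} S)

def funSymbol {n : ℕ} (f : (Fin n → S) → S) : (fullLanguage S).Functions n := f

def relSymbol {n : ℕ} (R : Set (Fin n → S)) : (fullLanguage S).Relations n := R

variable {X Y Z : Type*} (i : X ↪ S) (j : Y ↪ S) (l : Z ↪ S)

/-- `X`, included in `S` by `i`, as a unary relation symbol. -/
def domSymbol : (fullLanguage S).Relations 1 := relSymbol {s | s 0 ∈ Set.range i}

/-- The relation on `S` carried over from a relation on `X ⊆ S`. -/
def imageSymbol {n : ℕ} (R : Set (Fin n → X)) : (fullLanguage S).Relations n :=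
  relSymbol {s | ∃ p ∈ R, s = i ∘ p}

/-- A function `Xⁿ → Y`, extended arbitrarily to a function `Sⁿ → S`. -/
def extendSymbol [Nonempty Y] {n : ℕ} (f : (Fin n → X) → Y) : (fullLanguage S).Functions n :=
  funSymbol (Function.extend (fun p => i ∘ p) (fun p => j (f p)) fun _ => j (Classical.arbitrary Y))

/-- The nonstandard extension `*X ⊆ *S` of a set `X`, included in `S` by `i`. -/
def Star : Type w := {x : E.carrier // FirstOrder.Language.Structure.RelMap (domSymbol i) ![x]}

variable {E i j l}

theorem comp_injective (n : ℕ) : Function.Injective (fun p : Fin n → X => i ∘ p) :=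
  i.injective.comp_left

theorem extendSymbol_apply [Nonempty Y] {n : ℕ} (f : (Fin n → X) → Y) (p : Fin n → X) :
    FirstOrder.Language.Structure.funMap (extendSymbol i j f) (i ∘ p) = j (f p) :=
  (comp_injective (i := i) n).extend_apply (fun p => j (f p)) (fun _ => j (Classical.arbitrary Y)) p

theorem relMap_domSymbol (s : S) :
    FirstOrder.Language.Structure.RelMap (domSymbol i) ![s] ↔ s ∈ Set.range i := Iff.rfl

theorem relMap_imageSymbol {n : ℕ} (R : Set (Fin n → X)) (p : Fin n → X) :
    FirstOrder.Language.Structure.RelMap (imageSymbol i R) (i ∘ p) ↔ p ∈ R :=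
  ⟨fun ⟨_, hq, h⟩ => (comp_injective (i := i) n h) ▸ hq, fun h => ⟨p, h, rfl⟩⟩

/-- The Transfer Principle for statements of the form `∀ x ∈ Xⁿ, φ(x)`. -/
theorem transfer {n : ℕ} (φ : (fullLanguage S).Formula (Fin n))
    (h : ∀ p : Fin n → X, φ.Realize (i ∘ p)) (x : Fin n → E.Star i) :
    φ.Realize (fun k => (x k).1) := by
  let ψ : (fullLanguage S).Formula (Empty ⊕ Fin n) :=
    ((FirstOrder.Language.Formula.iInf fun k : Fin n =>
      (FirstOrder.Language.Relations.formula₁ (domSymbol i) (FirstOrder.Language.var k))).imp φ).relabel Sum.inr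
  have hS : S ⊨ (ψ.iAlls (Fin n) : (fullLanguage S).Sentence) := by
    simp only [FirstOrder.Language.Sentence.Realize, FirstOrder.Language.Formula.realize_iAlls]
    intro s
    simp only [ψ, FirstOrder.Language.Formula.realize_relabel, FirstOrder.Language.Formula.realize_imp,
      FirstOrder.Language.Formula.realize_iInf, FirstOrder.Language.Formula.realize_rel₁]
    intro hs
    choose p hp using fun k => (relMap_domSymbol (i := i) _).1 (hs k)
    have : i ∘ p = (Sum.elim (default : Empty → S) s ∘ Sum.inr) := by
      funext k; simpa using hp k
    exact this ▸ h p
  have hE := (E.emb.map_sentence (ψ.iAlls (Fin n))).1 hS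
  simp only [FirstOrder.Language.Sentence.Realize, FirstOrder.Language.Formula.realize_iAlls] at hE
  have := hE (fun k => (x k).1)
  simp only [ψ, FirstOrder.Language.Formula.realize_relabel, FirstOrder.Language.Formula.realize_imp,
      FirstOrder.Language.Formula.realize_iInf, FirstOrder.Language.Formula.realize_rel₁] at this
  exact this fun k => (x k).2


variable (E i j) in
/-- The extension `*f : (*X)ⁿ → *Y` of a function `f : Xⁿ → Y`. -/
def starFun [Nonempty Y] {n : ℕ} (f : (Fin n → X) → Y) (x : Fin n → E.Star i) : E.Star j :=
  ⟨FirstOrder.Language.Structure.funMap (extendSymbol i j f) (fun k => (x k).1), by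
    have := transfer (E := E) (i := i) (FirstOrder.Language.Relations.formula₁ (domSymbol j)
      (FirstOrder.Language.Term.func (extendSymbol i j f) FirstOrder.Language.var)) (fun p => by
        rw [FirstOrder.Language.Formula.realize_rel₁, FirstOrder.Language.Term.realize_func]
        exact ⟨f p, (extendSymbol_apply f p).symm⟩) x
    rwa [FirstOrder.Language.Formula.realize_rel₁, FirstOrder.Language.Term.realize_func] at this⟩

variable (E i) in
/-- The extension `*R` of a relation `R ⊆ Xⁿ`. -/
def starRel {n : ℕ} (R : Set (Fin n → X)) : Set (Fin n → E.Star i) :=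
  {x | FirstOrder.Language.Structure.RelMap (imageSymbol i R) (fun k => (x k).1)}

variable (E i) in
/-- The canonical inclusion `X → *X`. -/
def embed (a : X) : E.Star i :=
  ⟨E.emb (i a), by
    have h : FirstOrder.Language.Structure.RelMap (domSymbol i) ![i a] := ⟨a, rfl⟩
    rw [← E.emb.map_rel] at h
    convert h using 1
    funext k; fin_cases k; rfl⟩

theorem starFun_comp [Nonempty Y] [Nonempty Z] {m n : ℕ} (g : (Fin m → Y) → Z)
    (f : Fin m → (Fin n → X) → Y) (x : Fin n → E.Star i) :
    E.starFun j l g (fun k => E.starFun i j (f k) x) =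
      E.starFun i l (fun p => g fun k => f k p) x := by
  have := transfer (E := E) (i := i) (FirstOrder.Language.Term.equal
    (FirstOrder.Language.Term.func (extendSymbol j l g) fun k =>
      FirstOrder.Language.Term.func (extendSymbol i j (f k)) FirstOrder.Language.var)
    (FirstOrder.Language.Term.func (extendSymbol i l (fun p => g fun k => f k p))
      FirstOrder.Language.var)) (fun p => by
        simp only [FirstOrder.Language.Formula.realize_equal,
          FirstOrder.Language.Term.realize_func, FirstOrder.Language.Term.realize_var]
        have h (k) : FirstOrder.Language.Structure.funMap (extendSymbol i j (f k))
          (fun a => (i ∘ p) a) = j (f k p) := extendSymbol_apply (f k) p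
        simp only [h]
        exact (extendSymbol_apply g fun k => f k p).trans
          (extendSymbol_apply (fun p => g fun k => f k p) p).symm) x
  simp only [FirstOrder.Language.Formula.realize_equal,
    FirstOrder.Language.Term.realize_func, FirstOrder.Language.Term.realize_var] at this
  exact Subtype.ext this

theorem starFun_proj [Nonempty X] {n : ℕ} (k : Fin n) (x : Fin n → E.Star i) :
    E.starFun i i (fun p => p k) x = x k := by
  have := transfer (E := E) (i := i) (FirstOrder.Language.Term.equal
    (FirstOrder.Language.Term.func (extendSymbol i i fun p : Fin n → X => p k)
      FirstOrder.Language.var) (FirstOrder.Language.var k)) (fun p => by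
        simp only [FirstOrder.Language.Formula.realize_equal,
          FirstOrder.Language.Term.realize_func, FirstOrder.Language.Term.realize_var]
        exact extendSymbol_apply (fun p : Fin n → X => p k) p) x
  simp only [FirstOrder.Language.Formula.realize_equal,
    FirstOrder.Language.Term.realize_func, FirstOrder.Language.Term.realize_var] at this
  exact Subtype.ext this

theorem starFun_embed [Nonempty Y] {n : ℕ} (f : (Fin n → X) → Y) (p : Fin n → X) :
    E.starFun i j f (fun k => E.embed i (p k)) = E.embed j (f p) := by
  refine Subtype.ext ?_
  have := E.emb.map_fun (extendSymbol i j f) (i ∘ p)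
  rw [extendSymbol_apply] at this
  exact this.symm

theorem starFun_const [Nonempty Y] {n : ℕ} (c : Y) (x : Fin n → E.Star i) :
    E.starFun i j (fun _ => c) x = E.embed j c := by
  have h := starFun_comp (E := E) (i := i) (j := j) (l := j) (m := 0) (fun _ => c)
    (fun k => k.elim0) x
  rw [← h, ← starFun_embed (E := E) (i := j) (fun _ => c) (fun k : Fin 0 => k.elim0)]
  congr 1
  exact Subsingleton.elim _ _

theorem starRel_comp [Nonempty Y] {m n : ℕ} (R : Set (Fin m → Y))
    (f : Fin m → (Fin n → X) → Y) (x : Fin n → E.Star i) :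
    (fun k => E.starFun i j (f k) x) ∈ E.starRel j R ↔
      x ∈ E.starRel i {p | (fun k => f k p) ∈ R} := by
  have := transfer (E := E) (i := i) ((FirstOrder.Language.Relations.formula (imageSymbol j R)
    fun k => FirstOrder.Language.Term.func (extendSymbol i j (f k)) FirstOrder.Language.var).iff
    (FirstOrder.Language.Relations.formula (imageSymbol i {p | (fun k => f k p) ∈ R})
      FirstOrder.Language.var)) (fun p => by
        simp only [FirstOrder.Language.Formula.realize_iff, FirstOrder.Language.Formula.realize_rel,
          FirstOrder.Language.Term.realize_func, FirstOrder.Language.Term.realize_var]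
        have h (k) : FirstOrder.Language.Structure.funMap (extendSymbol i j (f k))
          (fun a => (i ∘ p) a) = j (f k p) := extendSymbol_apply (f k) p
        simp only [h]
        exact (relMap_imageSymbol R fun k => f k p).trans
          (relMap_imageSymbol {p | (fun k => f k p) ∈ R} p).symm) x
  simp only [FirstOrder.Language.Formula.realize_iff, FirstOrder.Language.Formula.realize_rel,
    FirstOrder.Language.Term.realize_func, FirstOrder.Language.Term.realize_var] at this
  exact this

theorem starRel_imp {n : ℕ} {Q R T : Set (Fin n → X)} (h : ∀ p, p ∈ Q → p ∈ R → p ∈ T)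
    {x : Fin n → E.Star i} (hQ : x ∈ E.starRel i Q) (hR : x ∈ E.starRel i R) :
    x ∈ E.starRel i T := by
  have := transfer (E := E) (i := i)
    ((FirstOrder.Language.Relations.formula (imageSymbol i Q) FirstOrder.Language.var).imp
    ((FirstOrder.Language.Relations.formula (imageSymbol i R) FirstOrder.Language.var).imp
    (FirstOrder.Language.Relations.formula (imageSymbol i T) FirstOrder.Language.var))) (fun p => by
        simp only [FirstOrder.Language.Formula.realize_imp, FirstOrder.Language.Formula.realize_rel,
          FirstOrder.Language.Term.realize_var]
        exact fun h1 h2 => (relMap_imageSymbol T p).2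
          (h p ((relMap_imageSymbol Q p).1 h1) ((relMap_imageSymbol R p).1 h2))) x
  simp only [FirstOrder.Language.Formula.realize_imp, FirstOrder.Language.Formula.realize_rel,
    FirstOrder.Language.Term.realize_var] at this
  exact this hQ hR

theorem starRel_of_forall {n : ℕ} {R : Set (Fin n → X)} (h : ∀ p, p ∈ R) (x : Fin n → E.Star i) :
    x ∈ E.starRel i R := by
  have := transfer (E := E) (i := i)
    (FirstOrder.Language.Relations.formula (imageSymbol i R) FirstOrder.Language.var) (fun p => by
        simp only [FirstOrder.Language.Formula.realize_rel,
          FirstOrder.Language.Term.realize_var]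
        exact (relMap_imageSymbol R p).2 (h p)) x
  simp only [FirstOrder.Language.Formula.realize_rel, FirstOrder.Language.Term.realize_var] at this
  exact this

/-! ### Ring operations and order on nonstandard extensions -/

instance [Zero X] : Zero (E.Star i) := ⟨E.embed i 0⟩

instance [One X] : One (E.Star i) := ⟨E.embed i 1⟩

instance [CommRing X] : Add (E.Star i) :=
  ⟨fun a b => E.starFun i i (fun p : Fin 2 → X => p 0 + p 1) ![a, b]⟩

instance [CommRing X] : Mul (E.Star i) :=
  ⟨fun a b => E.starFun i i (fun p : Fin 2 → X => p 0 * p 1) ![a, b]⟩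

instance [CommRing X] : Neg (E.Star i) :=
  ⟨fun a => E.starFun i i (fun p : Fin 1 → X => -p 0) ![a]⟩

instance [LT X] : LT (E.Star i) := ⟨fun a b => ![a, b] ∈ E.starRel i {p | p 0 < p 1}⟩

instance [LE X] : LE (E.Star i) := ⟨fun a b => ![a, b] ∈ E.starRel i {p | p 0 ≤ p 1}⟩

theorem starFun_add [CommRing Y] {n : ℕ} (f g : (Fin n → X) → Y) (x : Fin n → E.Star i) :
    E.starFun i j f x + E.starFun i j g x = E.starFun i j (fun p => f p + g p) x := by
  refine Eq.trans ?_ (starFun_comp (E := E) (j := j) (fun p : Fin 2 → Y => p 0 + p 1) ![f, g] x)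
  change E.starFun j j _ _ = _
  congr 1; funext k; fin_cases k <;> rfl

theorem starFun_mul [CommRing Y] {n : ℕ} (f g : (Fin n → X) → Y) (x : Fin n → E.Star i) :
    E.starFun i j f x * E.starFun i j g x = E.starFun i j (fun p => f p * g p) x := by
  refine Eq.trans ?_ (starFun_comp (E := E) (j := j) (fun p : Fin 2 → Y => p 0 * p 1) ![f, g] x)
  change E.starFun j j _ _ = _
  congr 1; funext k; fin_cases k <;> rfl

theorem starFun_neg [CommRing Y] {n : ℕ} (f : (Fin n → X) → Y) (x : Fin n → E.Star i) :
    -E.starFun i j f x = E.starFun i j (fun p => -f p) x := by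
  refine Eq.trans ?_ (starFun_comp (E := E) (j := j) (fun p : Fin 1 → Y => -p 0) ![f] x)
  change E.starFun j j _ _ = _
  congr 1; funext k; fin_cases k; rfl

theorem starFun_lt [LT Y] [Nonempty Y] {n : ℕ} (f g : (Fin n → X) → Y) (x : Fin n → E.Star i) :
    E.starFun i j f x < E.starFun i j g x ↔ x ∈ E.starRel i {p | f p < g p} := by
  have h := starRel_comp (E := E) (j := j) {p : Fin 2 → Y | p 0 < p 1} ![f, g] x
  refine Iff.trans ?_ h
  change _ ∈ E.starRel j _ ↔ _
  have e : ![E.starFun i j f x, E.starFun i j g x] =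
      fun k => E.starFun i j ((![f, g] : Fin 2 → (Fin n → X) → Y) k) x := by
    funext k; fin_cases k <;> rfl
  rw [e]

theorem starFun_le [LE Y] [Nonempty Y] {n : ℕ} (f g : (Fin n → X) → Y) (x : Fin n → E.Star i) :
    E.starFun i j f x ≤ E.starFun i j g x ↔ x ∈ E.starRel i {p | f p ≤ g p} := by
  have h := starRel_comp (E := E) (j := j) {p : Fin 2 → Y | p 0 ≤ p 1} ![f, g] x
  refine Iff.trans ?_ h
  change _ ∈ E.starRel j _ ↔ _
  have e : ![E.starFun i j f x, E.starFun i j g x] =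
      fun k => E.starFun i j ((![f, g] : Fin 2 → (Fin n → X) → Y) k) x := by
    funext k; fin_cases k <;> rfl
  rw [e]

theorem starFun_congr [Nonempty Y] {n : ℕ} {f g : (Fin n → X) → Y} (h : ∀ p, f p = g p)
    (x : Fin n → E.Star i) : E.starFun i j f x = E.starFun i j g x := by rw [funext h]

theorem zero_eq_starFun [CommRing X] {n : ℕ} (x : Fin n → E.Star i) :
    (0 : E.Star i) = E.starFun i i (fun _ => 0) x := (starFun_const 0 x).symm

theorem one_eq_starFun [CommRing X] {n : ℕ} (x : Fin n → E.Star i) :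
    (1 : E.Star i) = E.starFun i i (fun _ => 1) x := (starFun_const 1 x).symm

/-- `*X` is a commutative ring if `X` is one, by transfer of the ring axioms. -/
instance [CommRing X] : CommRing (E.Star i) := CommRing.ofMinimalAxioms
  (by
    intro a b c
    change ![a, b, c] 0 + ![a, b, c] 1 + ![a, b, c] 2 = ![a, b, c] 0 + (![a, b, c] 1 + ![a, b, c] 2)
    simp only [← starFun_proj (E := E) (i := i) _ ![a, b, c], starFun_add]
    exact starFun_congr (fun p => add_assoc _ _ _) _)
  (by
    intro a
    change 0 + ![a] 0 = ![a] 0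
    rw [zero_eq_starFun ![a] ]
    simp only [← starFun_proj (E := E) (i := i) _ ![a], starFun_add]
    exact starFun_congr (fun p => zero_add _) _)
  (by
    intro a
    change -![a] 0 + ![a] 0 = 0
    rw [zero_eq_starFun ![a] ]
    simp only [← starFun_proj (E := E) (i := i) _ ![a], starFun_add, starFun_neg]
    exact starFun_congr (fun p => neg_add_cancel _) _)
  (by
    intro a b c
    change ![a, b, c] 0 * ![a, b, c] 1 * ![a, b, c] 2 = ![a, b, c] 0 * (![a, b, c] 1 * ![a, b, c] 2)
    simp only [← starFun_proj (E := E) (i := i) _ ![a, b, c], starFun_mul]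
    exact starFun_congr (fun p => mul_assoc _ _ _) _)
  (by
    intro a b
    change ![a, b] 0 * ![a, b] 1 = ![a, b] 1 * ![a, b] 0
    simp only [← starFun_proj (E := E) (i := i) _ ![a, b], starFun_mul]
    exact starFun_congr (fun p => mul_comm _ _) _)
  (by
    intro a
    change 1 * ![a] 0 = ![a] 0
    rw [one_eq_starFun ![a] ]
    simp only [← starFun_proj (E := E) (i := i) _ ![a], starFun_mul]
    exact starFun_congr (fun p => one_mul _) _)
  (by
    intro a b c
    change ![a, b, c] 0 * (![a, b, c] 1 + ![a, b, c] 2) =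
      ![a, b, c] 0 * ![a, b, c] 1 + ![a, b, c] 0 * ![a, b, c] 2
    simp only [← starFun_proj (E := E) (i := i) _ ![a, b, c], starFun_mul, starFun_add]
    exact starFun_congr (fun p => mul_add _ _ _) _)

end NonstandardExtension

/-! ### The nonstandard number field and its adelic subquotient -/

namespace NonstandardAdele

open NumberField NonstandardExtension Topology Filter IsDedekindDomain

/-- The places of a number field: the Archimedean and the non-Archimedean ones. -/
abbrev Place (K : Type*) [Field K] [NumberField K] := InfinitePlace K ⊕ FinitePlace K

/-- The (normalized) absolute value `|·|_v` on `K` of a place `v`. -/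
def Place.abv {K : Type*} [Field K] [NumberField K] : Place K → AbsoluteValue K ℝ
  | .inl v => v.1
  | .inr v => v.1

/-- The set of Archimedean places. -/
def Arch (K : Type*) [Field K] [NumberField K] : Set (Place K) := Set.range Sum.inl

theorem abv_add_le_one {K : Type*} [Field K] [NumberField K] {v : Place K} (hv : v ∉ Arch K)
    {a b : K} (ha : v.abv a ≤ 1) (hb : v.abv b ≤ 1) : v.abv (a + b) ≤ 1 := by
  rcases v with v | v
  · exact absurd ⟨v, rfl⟩ hv
  · exact (FinitePlace.add_le v a b).trans (max_le ha hb)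

variable {K : Type*} [Field K] [NumberField K] {S : Type u} (E : NonstandardExtension.{u, w} S)
  (iK : K ↪ S) (iR : ℝ ↪ S)

/-- The extension `|·|_v : *K → *ℝ` of the absolute value of a standard place `v`. -/
def starAbv (v : Place K) (x : E.Star iK) : E.Star iR :=
  E.starFun iK iR (fun p : Fin 1 → K => v.abv (p 0)) ![x]

variable {E iK iR}

theorem starAbv_starFun (v : Place K) {n : ℕ} (f : (Fin n → K) → K) (x : Fin n → E.Star iK) :
    starAbv E iK iR v (E.starFun iK iK f x) = E.starFun iK iR (fun p => v.abv (f p)) x := by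
  refine Eq.trans ?_ (starFun_comp (E := E) (j := iK) (fun p : Fin 1 → K => v.abv (p 0))
    (fun _ => f) x)
  unfold starAbv
  congr 1; funext k; fin_cases k; rfl

theorem starAbv_starFun_lt (v : Place K) {n : ℕ} (f : (Fin n → K) → K) (x : Fin n → E.Star iK)
    (r : ℝ) : starAbv E iK iR v (E.starFun iK iK f x) < E.embed iR r ↔
      x ∈ E.starRel iK {p | v.abv (f p) < r} := by
  rw [starAbv_starFun, ← starFun_const (E := E) (i := iK) r x, starFun_lt]

theorem starAbv_starFun_le (v : Place K) {n : ℕ} (f : (Fin n → K) → K) (x : Fin n → E.Star iK)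
    (r : ℝ) : starAbv E iK iR v (E.starFun iK iK f x) ≤ E.embed iR r ↔
      x ∈ E.starRel iK {p | v.abv (f p) ≤ r} := by
  rw [starAbv_starFun, ← starFun_const (E := E) (i := iK) r x, starFun_le]

theorem starAbv_lt_of (v : Place K) (f : (Fin 2 → K) → K) {r s t : ℝ}
    (h : ∀ p : Fin 2 → K, v.abv (p 0) < r → v.abv (p 1) < s → v.abv (f p) < t) {x y : E.Star iK}
    (hx : starAbv E iK iR v x < E.embed iR r) (hy : starAbv E iK iR v y < E.embed iR s) :
    starAbv E iK iR v (E.starFun iK iK f ![x, y]) < E.embed iR t := by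
  rw [starAbv_starFun_lt]
  refine starRel_imp h ((starAbv_starFun_lt (iR := iR) v _ _ _).1 ?_)
    ((starAbv_starFun_lt (iR := iR) v _ _ _).1 ?_)
  · rw [starFun_proj]; exact hx
  · rw [starFun_proj]; exact hy

theorem starAbv_le_of (v : Place K) (f : (Fin 2 → K) → K) {r s t : ℝ}
    (h : ∀ p : Fin 2 → K, v.abv (p 0) ≤ r → v.abv (p 1) ≤ s → v.abv (f p) ≤ t) {x y : E.Star iK}
    (hx : starAbv E iK iR v x ≤ E.embed iR r) (hy : starAbv E iK iR v y ≤ E.embed iR s) :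
    starAbv E iK iR v (E.starFun iK iK f ![x, y]) ≤ E.embed iR t := by
  rw [starAbv_starFun_le]
  refine starRel_imp h ((starAbv_starFun_le (iR := iR) v _ _ _).1 ?_)
    ((starAbv_starFun_le (iR := iR) v _ _ _).1 ?_)
  · rw [starFun_proj]; exact hx
  · rw [starFun_proj]; exact hy

theorem starAbv_add_lt {v : Place K} {r s : ℝ} {x y : E.Star iK}
    (hx : starAbv E iK iR v x < E.embed iR r) (hy : starAbv E iK iR v y < E.embed iR s) :
    starAbv E iK iR v (x + y) < E.embed iR (r + s) :=
  starAbv_lt_of v (fun p => p 0 + p 1)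
    (fun p h0 h1 => (v.abv.add_le (p 0) (p 1)).trans_lt (add_lt_add h0 h1)) hx hy

theorem starAbv_mul_lt {v : Place K} {r s : ℝ} {x y : E.Star iK}
    (hx : starAbv E iK iR v x < E.embed iR r) (hy : starAbv E iK iR v y < E.embed iR s) :
    starAbv E iK iR v (x * y) < E.embed iR (r * s) :=
  starAbv_lt_of v (fun p => p 0 * p 1)
    (fun p h0 h1 => (v.abv.map_mul (p 0) (p 1)).trans_lt
      (mul_lt_mul'' h0 h1 (v.abv.nonneg _) (v.abv.nonneg _))) hx hy

theorem starAbv_add_le_one {v : Place K} (hv : v ∉ Arch K) {x y : E.Star iK}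
    (hx : starAbv E iK iR v x ≤ 1) (hy : starAbv E iK iR v y ≤ 1) :
    starAbv E iK iR v (x + y) ≤ 1 :=
  starAbv_le_of v (fun p => p 0 + p 1) (fun _ h0 h1 => abv_add_le_one hv h0 h1) hx hy

theorem starAbv_mul_le_one {v : Place K} {x y : E.Star iK}
    (hx : starAbv E iK iR v x ≤ 1) (hy : starAbv E iK iR v y ≤ 1) :
    starAbv E iK iR v (x * y) ≤ 1 :=
  starAbv_le_of v (fun p => p 0 * p 1)
    (fun p h0 h1 => (v.abv.map_mul (p 0) (p 1)).trans_le
      (mul_le_one₀ h0 (v.abv.nonneg _) h1)) hx hy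

theorem starAbv_neg (v : Place K) (x : E.Star iK) :
    starAbv E iK iR v (-x) = starAbv E iK iR v x := by
  refine (starAbv_starFun v (fun p : Fin 1 → K => -p 0) ![x]).trans ?_
  exact starFun_congr (fun p => v.abv.map_neg _) _

theorem starAbv_embed (v : Place K) (a : K) :
    starAbv E iK iR v (E.embed iK a) = E.embed iR (v.abv a) := by
  refine Eq.trans ?_
    (starFun_embed (E := E) (i := iK) (j := iR) (fun p : Fin 1 → K => v.abv (p 0)) ![a])
  unfold starAbv
  congr 1; funext k; fin_cases k; rfl

theorem embed_lt {r s : ℝ} (h : r < s) : E.embed iR r < E.embed iR s := by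
  rw [← starFun_const (E := E) (i := iR) r ![0], ← starFun_const (E := E) (i := iR) s ![0],
    starFun_lt]
  exact starRel_of_forall (fun _ => h) _

theorem embed_le {r s : ℝ} (h : r ≤ s) : E.embed iR r ≤ E.embed iR s := by
  rw [← starFun_const (E := E) (i := iR) r ![0], ← starFun_const (E := E) (i := iR) s ![0],
    starFun_le]
  exact starRel_of_forall (fun _ => h) _

theorem starAbv_zero (v : Place K) : starAbv E iK iR v 0 = E.embed iR 0 := by
  have := starAbv_embed (E := E) (iK := iK) (iR := iR) v 0
  rwa [v.abv.map_zero] at this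

theorem starAbv_one (v : Place K) : starAbv E iK iR v 1 = E.embed iR 1 := by
  have := starAbv_embed (E := E) (iK := iK) (iR := iR) v 1
  rwa [v.abv.map_one] at this

variable (E iK iR)

/-- The uniform structure on `*K` generated by the entourages `{(x, y) | |x - y|_v < ε}`
for all places `v` of `K` and all standard real `ε > 0`. -/
@[reducible]
def starUniformSpace : UniformSpace (E.Star iK) := .ofCore {
  uniformity := ⨅ (v : Place K) (ε : ℝ) (_ : 0 < ε),
    𝓟 {z | starAbv E iK iR v (z.1 - z.2) < E.embed iR ε}
  refl := by
    refine le_iInf fun v => le_iInf fun ε => le_iInf fun hε => principal_mono.2 ?_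
    rintro ⟨x, y⟩ hxy
    obtain rfl : x = y := hxy
    change starAbv E iK iR v (x - x) < _
    rw [sub_self, starAbv_zero]
    exact embed_lt hε
  symm := by
    simp only [tendsto_iInf, tendsto_principal]
    intro v ε hε
    refine mem_iInf_of_mem v (mem_iInf_of_mem ε (mem_iInf_of_mem hε ?_))
    rintro ⟨x, y⟩ hxy
    change starAbv E iK iR v (y - x) < _
    rw [← starAbv_neg, neg_sub]
    exact hxy
  comp := by
    refine le_iInf fun v => le_iInf fun ε => le_iInf fun hε => ?_
    refine (lift'_le (mem_iInf_of_mem v (mem_iInf_of_mem (ε / 2)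
      (mem_iInf_of_mem (half_pos hε) (mem_principal_self _)))) (principal_mono.2 ?_))
    rintro ⟨x, z⟩ ⟨y, hxy, hyz⟩
    have := starAbv_add_lt hxy hyz
    rw [add_halves, sub_add_sub_cancel] at this
    exact this }

/-- `fin_V(*K)`: the elements of `*K` whose absolute value is finite at all places of `K`. -/
def finV : Subring (E.Star iK) where
  carrier := {x | ∀ v : Place K, ∃ r : ℝ, starAbv E iK iR v x < E.embed iR r}
  zero_mem' v := ⟨1, by rw [starAbv_zero]; exact embed_lt one_pos⟩
  one_mem' v := ⟨2, by rw [starAbv_one]; exact embed_lt one_lt_two⟩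
  add_mem' hx hy v := let ⟨_, hr⟩ := hx v; let ⟨_, hs⟩ := hy v; ⟨_, starAbv_add_lt hr hs⟩
  mul_mem' hx hy v := let ⟨_, hr⟩ := hx v; let ⟨_, hs⟩ := hy v; ⟨_, starAbv_mul_lt hr hs⟩
  neg_mem' hx v := let ⟨r, hr⟩ := hx v; ⟨r, by rwa [starAbv_neg]⟩

/-- `fin_{V,T}(*K)`: the elements `x` of `fin_V(*K)` with `|x|_v ≤ 1` for all `v ∉ T ∪ Arch`. -/
def finVS (T : Finset (Place K)) : Subring (E.Star iK) where
  carrier := {x | x ∈ finV E iK iR ∧ ∀ v : Place K, v ∉ (T : Set (Place K)) ∪ Arch K →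
    starAbv E iK iR v x ≤ 1}
  zero_mem' := ⟨zero_mem _, fun v _ => by rw [starAbv_zero]; exact embed_le zero_le_one⟩
  one_mem' := ⟨one_mem _, fun v _ => by rw [starAbv_one]; exact embed_le le_rfl⟩
  add_mem' hx hy := ⟨add_mem hx.1 hy.1, fun v hv =>
    starAbv_add_le_one (fun h => hv (Or.inr h)) (hx.2 v hv) (hy.2 v hv)⟩
  mul_mem' hx hy := ⟨mul_mem hx.1 hy.1, fun v hv => starAbv_mul_le_one (hx.2 v hv) (hy.2 v hv)⟩
  neg_mem' hx := ⟨neg_mem hx.1, fun v hv => by rw [starAbv_neg]; exact hx.2 v hv⟩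

/-- `fin'_V(*K)`: the direct limit (directed union) of the subrings `fin_{V,T}(*K)` over all finite
sets `T` of places. -/
def finV' : Subring (E.Star iK) := ⨆ T : Finset (Place K), finVS E iK iR T

variable {E iK iR} in
theorem mem_finV' {x : E.Star iK} :
    x ∈ finV' E iK iR ↔ ∃ T : Finset (Place K), x ∈ finVS E iK iR T := by
  classical
  refine Subring.mem_iSup_of_directed fun T T' => ⟨T ∪ T', ?_, ?_⟩
  · exact fun x hx => ⟨hx.1, fun v hv => hx.2 v fun h => hv (h.imp_left fun h => by simp_all)⟩
  · exact fun x hx => ⟨hx.1, fun v hv => hx.2 v fun h => hv (h.imp_left fun h => by simp_all)⟩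

/-- `fin_{V,T}(*K)` carries the subspace topology of `*K`. -/
instance finVSTopology (T : Finset (Place K)) : TopologicalSpace (finVS E iK iR T) :=
  (starUniformSpace E iK iR).toTopologicalSpace.induced Subtype.val

/-- `fin'_V(*K)` carries the final topology with respect to the inclusions of all
`fin_{V,T}(*K)`. -/
instance finV'Topology : TopologicalSpace (finV' E iK iR) :=
  ⨆ T : Finset (Place K), (finVSTopology E iK iR T).coinduced
    (Subring.inclusion (le_iSup (finVS E iK iR) T))

/-- `inf_V(*K)`: the elements whose absolute value is infinitesimal at all places of `K`, as an
ideal of `fin'_V(*K)`. -/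
def infV : Ideal (finV' E iK iR) where
  carrier := {x | ∀ (v : Place K) (ε : ℝ), 0 < ε → starAbv E iK iR v x < E.embed iR ε}
  zero_mem' v ε hε := by
    rw [ZeroMemClass.coe_zero, starAbv_zero]; exact embed_lt hε
  add_mem' hx hy v ε hε := by
    have := starAbv_add_lt (hx v (ε / 2) (half_pos hε)) (hy v (ε / 2) (half_pos hε))
    rw [add_halves] at this
    exact this
  smul_mem' c x hx v ε hε := by
    obtain ⟨T, hT⟩ := mem_finV'.1 c.2
    obtain ⟨r, hr⟩ := hT.1 v
    refine starAbv_lt_of v (fun p => p 0 * p 1) (s := ε / (|r| + 1)) (fun p h0 h1 => ?_) hr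
      (hx v _ (by positivity))
    have h2 : v.abv (p 0) < |r| + 1 := h0.trans ((le_abs_self r).trans_lt (lt_add_one _))
    calc v.abv (p 0 * p 1) = v.abv (p 0) * v.abv (p 1) := v.abv.map_mul _ _
      _ < (|r| + 1) * (ε / (|r| + 1)) := mul_lt_mul'' h2 h1 (v.abv.nonneg _) (v.abv.nonneg _)
      _ = ε := mul_div_cancel₀ _ (by positivity)

/-- The adele `a` is the standard part of `x ∈ *K` at all places `v`: whenever `k ∈ K` satisfies
`|a_v - k|_v < ε` in `K_v`, also `|x - k|_v < ε` in `*K`. -/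
def IsStandardPart (x : E.Star iK) (a : AdeleRing (𝓞 K) K) : Prop :=
  (∀ (v : InfinitePlace K) (k : K) (ε : ℝ), ‖a.1 v - algebraMap K v.Completion k‖ < ε →
    starAbv E iK iR (.inl v) (x - E.embed iK k) < E.embed iR ε) ∧
  (∀ (v : HeightOneSpectrum (𝓞 K)) (k : K) (ε : ℝ),
    ‖a.2 v - algebraMap K (v.adicCompletion K) k‖ < ε →
      starAbv E iK iR (.inr (FinitePlace.mk v)) (x - E.embed iK k) < E.embed iR ε)

end NonstandardAdele

end

open NonstandardAdele NumberField

/-!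
The type of a point `x` of `*X` is the ultrafilter of all standard sets whose extension contains
`x`, and `x` has a standard part in a space containing `X` exactly when this ultrafilter converges
there. Since the completions `K_v` are proper, every `v`-finite `x ∈ *K` has a standard part in
`K_v`. By countable saturation every proper countably generated filter is coarser than the type of
some point. As `K` has countably many places and is dense in `∏_v K_v` by weak approximation, every
family of local values, in particular every adele, is a standard part: this makes `Φ` surjective.

The uniform structure of `*K` is generated by the absolute values, so `fin_{V,T}(*K)` carries the
topology induced from `∏_v K_v`, and therefore also the one induced from `A_K`. Moreover it is the
preimage under `Φ` of the open set of adeles integral outside `T`. Hence the final topology on the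
union `fin'_V(*K)` is the one induced by `Φ`, and the topological assertions hold for any
surjective ring homomorphism that induces the topology of its domain.
-/

section Topology

open Topology Set

theorem denseRange_pi_of_forall_finset {ι X : Type*} {Y : ι → Type*} [∀ i, TopologicalSpace (Y i)]
    {f : X → ∀ i, Y i} (h : ∀ s : Finset ι, DenseRange fun x (i : s) => f x i) : DenseRange f := by
  refine dense_iff_inter_open.2 fun U hU ⟨a, ha⟩ => ?_
  obtain ⟨s, u, hu, hsU⟩ := isOpen_pi_iff.1 hU a ha
  obtain ⟨x, hx⟩ := (h s).exists_mem_open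
    (isOpen_set_pi finite_univ fun (i : s) _ => (hu i i.2).1)
    ⟨fun i => a i, fun i _ => (hu i i.2).2⟩
  exact ⟨f x, hsU fun i hi => hx ⟨i, hi⟩ trivial, mem_range_self x⟩

theorem isInducing_of_iSup_coinduced {ι X A : Type*} {Y : ι → Type*} [tX : TopologicalSpace X]
    [tY : ∀ i, TopologicalSpace (Y i)] [TopologicalSpace A] {g : ∀ i, Y i → X} {f : X → A}
    {U : ι → Set A} (hX : tX = ⨆ i, (tY i).coinduced (g i)) (hU : ∀ i, IsOpen (U i))
    (hrange : ∀ i, range (g i) = f ⁻¹' U i) (hcover : ∀ x, ∃ i, f x ∈ U i)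
    (hf : ∀ i, IsInducing (f ∘ g i)) : IsInducing f := by
  have hcont : Continuous f := by
    subst hX
    exact continuous_iSup_dom.2 fun i => continuous_coinduced_dom.2 (hf i).continuous
  refine ⟨le_antisymm hcont.le_induced fun s hs => isOpen_induced_iff.2 ?_⟩
  have hs (i) : IsOpen (g i ⁻¹' s) := by
    subst hX
    exact isOpen_coinduced.1 (isOpen_iSup_iff.1 hs i)
  choose O hO hOs using fun i => (hf i).isOpen_iff.1 (hs i)
  refine ⟨⋃ i, O i ∩ U i, isOpen_iUnion fun i => (hO i).inter (hU i), ?_⟩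
  have hmem (i) (y : Y i) : f (g i y) ∈ O i ↔ g i y ∈ s := Set.ext_iff.1 (hOs i) y
  ext x
  simp only [mem_preimage, mem_iUnion, mem_inter_iff]
  constructor
  · rintro ⟨i, hxO, hxU⟩
    obtain ⟨y, rfl⟩ : x ∈ range (g i) := hrange i ▸ hxU
    exact (hmem i y).1 hxO
  · intro hx
    obtain ⟨i, hi⟩ := hcover x
    obtain ⟨y, rfl⟩ : x ∈ range (g i) := hrange i ▸ hi
    exact ⟨i, (hmem i y).2 hx, hi⟩

end Topology

section InducingRingHom

open Topology

section Ring

variable {R A : Type*} [Ring R] [TopologicalSpace R] [Ring A] [TopologicalSpace A] {f : R →+* A}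

theorem isTopologicalRing_of_isInducing [IsTopologicalRing A] (hf : IsInducing f) :
    IsTopologicalRing R :=
  have := hf.continuousMul f
  have := hf.continuousAdd f
  have : ContinuousNeg R :=
    ⟨hf.continuous_iff.2 (hf.continuous.neg.congr fun x => (map_neg f x).symm)⟩
  { }

theorem closure_zero_eq_ker_of_isInducing [T1Space A] (hf : IsInducing f) :
    closure ({0} : Set R) = RingHom.ker f := by
  rw [hf.closure_eq_preimage_closure_image, Set.image_singleton, map_zero, closure_singleton]
  rfl

theorem ker_separationQuotient_mkRingHom [IsTopologicalRing R] :
    (RingHom.ker (SeparationQuotient.mkRingHom (R := R)) : Set R) = closure {0} := by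
  ext x
  rw [← specializes_iff_mem_closure, specializes_iff_inseparable, SetLike.mem_coe,
    RingHom.mem_ker]
  exact SeparationQuotient.mk_eq_mk.trans ⟨.symm, .symm⟩

end Ring

section CommRing

variable {R A : Type*} [CommRing R] [TopologicalSpace R] [CommRing A] [TopologicalSpace A]
  {f : R →+* A}

theorem exists_ringEquiv_isHomeomorph_of_ker_eq {Q : Type*} [CommRing Q] [TopologicalSpace Q]
    {q : R →+* Q} (hq : IsQuotientMap q) (hf : IsQuotientMap f)
    (hker : RingHom.ker q = RingHom.ker f) :
    ∃ e : Q ≃+* A, IsHomeomorph e ∧ ∀ x, e (q x) = f x := by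
  let e : Q ≃+* A := (RingHom.quotientKerEquivOfSurjective hq.surjective).symm.trans
    ((Ideal.quotEquivOfEq hker).trans (RingHom.quotientKerEquivOfSurjective hf.surjective))
  have he (x : R) : e (q x) = f x := by
    simp only [e, RingEquiv.trans_apply]
    rw [(RingEquiv.symm_apply_eq _).2 (RingHom.quotientKerEquivOfSurjective_apply_mk
      hq.surjective x).symm]
    rfl
  have hcomp : e ∘ q = f := funext he
  refine ⟨e, isHomeomorph_iff_isQuotientMap_injective.2 ⟨?_, e.injective⟩, he⟩
  exact .of_comp hq.continuous (hq.continuous_iff.2 (hcomp ▸ hf.continuous)) (hcomp ▸ hf)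

theorem exists_quotient_ringEquiv_isHomeomorph (hf : IsQuotientMap f) {I : Ideal R}
    (hI : RingHom.ker f = I) :
    ∃ e : (R ⧸ I) ≃+* A, IsHomeomorph e ∧ ∀ x, e (Ideal.Quotient.mk I x) = f x :=
  exists_ringEquiv_isHomeomorph_of_ker_eq isQuotientMap_quot_mk hf (I.mk_ker.trans hI.symm)

theorem exists_separationQuotient_ringEquiv_isHomeomorph [IsTopologicalRing R]
    (hf : IsQuotientMap f) (hker : (RingHom.ker f : Set R) = closure {0}) :
    ∃ e : SeparationQuotient R ≃+* A, IsHomeomorph e ∧ ∀ x, e (SeparationQuotient.mk x) = f x :=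
  exists_ringEquiv_isHomeomorph_of_ker_eq (q := SeparationQuotient.mkRingHom)
    SeparationQuotient.isQuotientMap_mk hf
    (SetLike.coe_injective (ker_separationQuotient_mkRingHom.trans hker.symm))

end CommRing

end InducingRingHom

namespace NonstandardExtension

open Filter Topology

variable {S : Type u} {E : NonstandardExtension.{u, w} S} {X Y : Type*} {i : X ↪ S} {j : Y ↪ S}

section Ultrafilter

theorem notMem_starRel_empty {n : ℕ} (x : Fin n → E.Star i) : x ∉ E.starRel i ∅ := by
  have h := transfer (E := E)
    (FirstOrder.Language.Relations.formula (imageSymbol i (∅ : Set (Fin n → X)))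
      FirstOrder.Language.var).not
    (fun p => FirstOrder.Language.Formula.realize_not.2
      ((relMap_imageSymbol ∅ p).not.2 (Set.notMem_empty p))) x
  exact FirstOrder.Language.Formula.realize_not.1 h

theorem starRel_or_compl {n : ℕ} (R : Set (Fin n → X)) (x : Fin n → E.Star i) :
    x ∈ E.starRel i R ∨ x ∈ E.starRel i Rᶜ := by
  have h := transfer (E := E)
    (FirstOrder.Language.Relations.formula (imageSymbol i R) FirstOrder.Language.var ⊔
      FirstOrder.Language.Relations.formula (imageSymbol i Rᶜ) FirstOrder.Language.var)
    (fun p => FirstOrder.Language.Formula.realize_sup.2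
      ((em (p ∈ R)).imp (relMap_imageSymbol R p).2 (relMap_imageSymbol Rᶜ p).2)) x
  exact FirstOrder.Language.Formula.realize_sup.1 h

/-- The type of a tuple of nonstandard points: the ultrafilter of all standard relations whose
extension contains the tuple. -/
def tupleUltrafilter {n : ℕ} (x : Fin n → E.Star i) : Ultrafilter (Fin n → X) :=
  .ofComplNotMemIff
    { sets := {R | x ∈ E.starRel i R}
      univ_sets := starRel_of_forall Set.mem_univ x
      sets_of_superset := fun h hle => starRel_imp (fun _ hp _ => hle hp) h h
      inter_sets := starRel_imp fun _ => And.intro }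
    fun R => ⟨(starRel_or_compl R x).resolve_right, fun h h' =>
      notMem_starRel_empty x (starRel_imp (R := Rᶜ) (T := ∅) (fun _ hp hp' => hp' hp) h h')⟩

/-- The type of a nonstandard point: the ultrafilter of all standard sets whose extension contains
it. -/
def pointUltrafilter (x : E.Star i) : Ultrafilter X :=
  (tupleUltrafilter fun _ : Fin 1 => x).map (· 0)

theorem pointUltrafilter_starFun [Nonempty Y] {n : ℕ} (f : (Fin n → X) → Y) (x : Fin n → E.Star i) :
    pointUltrafilter (E.starFun i j f x) = (tupleUltrafilter x).map f :=
  Ultrafilter.ext fun s => starRel_comp {p | p 0 ∈ s} (fun _ => f) x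

theorem pointUltrafilter_apply [Nonempty X] {n : ℕ} (x : Fin n → E.Star i) (k : Fin n) :
    pointUltrafilter (x k) = (tupleUltrafilter x).map (· k) := by
  rw [← pointUltrafilter_starFun (j := i), starFun_proj]

theorem pointUltrafilter_embed (a : X) : pointUltrafilter (E.embed i a) = pure a := by
  have : Nonempty X := ⟨a⟩
  rw [← starFun_const a (Fin.elim0 : Fin 0 → E.Star i), pointUltrafilter_starFun]
  exact Ultrafilter.coe_injective (map_const (c := a))

theorem definable₁_setOf_mem_pointUltrafilter (s : Set X) :
    (Set.univ : Set E.carrier).Definable₁ (fullLanguage S)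
      (Subtype.val '' {x : E.Star i | s ∈ pointUltrafilter x}) := by
  have hrel (R : (fullLanguage S).Relations 1) : (Set.univ : Set E.carrier).Definable₁
      (fullLanguage S) {x | FirstOrder.Language.Structure.RelMap R ![x]} := by
    refine ⟨(FirstOrder.Language.lhomWithConstants _ _).onFormula
      (FirstOrder.Language.Relations.formula₁ R (FirstOrder.Language.var 0)), ?_⟩
    ext x
    simp only [Set.mem_ofPred_eq, FirstOrder.Language.LHom.realize_onFormula,
      FirstOrder.Language.Formula.realize_rel₁]
    rfl
  have himage : Subtype.val '' {x : E.Star i | s ∈ pointUltrafilter x} =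
      {x | FirstOrder.Language.Structure.RelMap (domSymbol i) ![x]} ∩
        {x | FirstOrder.Language.Structure.RelMap (imageSymbol i {p | p 0 ∈ s}) ![x]} := by
    ext x
    simp only [Set.mem_inter_iff, Set.mem_ofPred_eq, Matrix.vec_single_eq_const]
    exact ⟨fun ⟨y, hy, hyx⟩ => hyx ▸ ⟨Matrix.vec_single_eq_const y.1 ▸ y.2, hy⟩,
      fun ⟨hx, hs⟩ => ⟨⟨x, (Matrix.vec_single_eq_const x).symm ▸ hx⟩, hs, rfl⟩⟩
  rw [himage]
  exact (hrel _).inter (hrel _)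

theorem exists_pointUltrafilter_le (l : Filter X) [l.NeBot] [l.IsCountablyGenerated] :
    ∃ x : E.Star i, (pointUltrafilter x : Filter X) ≤ l := by
  obtain ⟨B, hB⟩ := l.exists_antitone_basis
  obtain ⟨x, hx⟩ := E.countably_saturated _
    (fun n => definable₁_setOf_mem_pointUltrafilter (i := i) (B n)) fun n => by
      obtain ⟨a, ha⟩ := hB.toHasBasis.neBot_iff.1 ‹_› (i := n) trivial
      have hmem (k) (hk : k ≤ n) : B k ∈ pointUltrafilter (E.embed i a) :=
        pointUltrafilter_embed (E := E) (i := i) a ▸ hB.antitone hk ha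
      exact ⟨(E.embed i a).1, Set.mem_iInter₂.2 fun k hk => ⟨_, hmem k hk, rfl⟩⟩
  obtain ⟨x, -, rfl⟩ := Set.mem_iInter.1 hx 0
  refine ⟨x, hB.toHasBasis.ge_iff.2 fun n _ => ?_⟩
  obtain ⟨y, hy, hyx⟩ := Set.mem_iInter.1 hx n
  exact Subtype.ext hyx ▸ hy

end Ultrafilter

section StandardPart

variable {F : Type*} [TopologicalSpace F] {φ : X → F}

/-- The nonstandard point `x` has standard part `a` in `F`, which is regarded as an enlargement of
`X` by means of `φ`: for every neighbourhood `U` of `a`, the point `x` lies in the extension of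
`φ ⁻¹' U`. -/
def HasStdPart (φ : X → F) (x : E.Star i) (a : F) : Prop :=
  Tendsto φ (pointUltrafilter x) (𝓝 a)

theorem HasStdPart.unique [T2Space F] {x : E.Star i} {a b : F} (ha : HasStdPart φ x a)
    (hb : HasStdPart φ x b) : a = b :=
  tendsto_nhds_unique ha hb

theorem hasStdPart_embed (φ : X → F) (a : X) : HasStdPart φ (E.embed i a) (φ a) := by
  rw [HasStdPart, pointUltrafilter_embed]
  exact tendsto_pure_nhds φ a

theorem exists_hasStdPart_of_eventually_mem {x : E.Star i} {C : Set F} (hC : IsCompact C)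
    (h : ∀ᶠ a in pointUltrafilter x, φ a ∈ C) : ∃ b, HasStdPart φ x b :=
  let ⟨b, _, hb⟩ := hC.ultrafilter_le_nhds ((pointUltrafilter x).map φ) (le_principal_iff.2 h)
  ⟨b, hb⟩

theorem HasStdPart.starFun [Nonempty X] [Nonempty Y] {G : Type*} [TopologicalSpace G] {ψ : Y → G}
    {n : ℕ} {x : Fin n → E.Star i} {a : Fin n → F} {f : (Fin n → X) → Y} {g : (Fin n → F) → G}
    (hx : ∀ k, HasStdPart φ (x k) (a k)) (hg : ContinuousAt g a)
    (hfg : ∀ p, ψ (f p) = g (φ ∘ p)) : HasStdPart ψ (E.starFun i j f x) (g a) := by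
  have hx : Tendsto (fun p : Fin n → X => φ ∘ p) (tupleUltrafilter x) (𝓝 a) := by
    refine tendsto_pi_nhds.2 fun k => ?_
    have h := hx k
    rw [HasStdPart, pointUltrafilter_apply] at h
    exact tendsto_map'_iff.1 h
  rw [HasStdPart, pointUltrafilter_starFun]
  exact tendsto_map'_iff.2 ((hg.tendsto.comp hx).congr fun p => (hfg p).symm)

end StandardPart

section RingStandardPart

variable [CommRing X] {F : Type*} [Ring F] [TopologicalSpace F] {φ : X →+* F} {x y : E.Star i}
  {a b : F}

theorem HasStdPart.add [ContinuousAdd F] (hx : HasStdPart φ x a) (hy : HasStdPart φ y b) :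
    HasStdPart φ (x + y) (a + b) :=
  HasStdPart.starFun (x := ![x, y]) (a := ![a, b]) (g := fun q => q 0 + q 1)
    (Fin.forall_fin_two.2 ⟨hx, hy⟩) (by fun_prop) fun p => map_add φ (p 0) (p 1)

theorem HasStdPart.mul [ContinuousMul F] (hx : HasStdPart φ x a) (hy : HasStdPart φ y b) :
    HasStdPart φ (x * y) (a * b) :=
  HasStdPart.starFun (x := ![x, y]) (a := ![a, b]) (g := fun q => q 0 * q 1)
    (Fin.forall_fin_two.2 ⟨hx, hy⟩) (by fun_prop) fun p => map_mul φ (p 0) (p 1)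

theorem HasStdPart.neg [ContinuousNeg F] (hx : HasStdPart φ x a) : HasStdPart φ (-x) (-a) :=
  HasStdPart.starFun (x := ![x]) (a := ![a]) (g := fun q => -q 0)
    (Fin.forall_fin_one.2 hx) (continuous_apply 0).neg.continuousAt fun p => map_neg φ (p 0)

theorem HasStdPart.sub [IsTopologicalRing F] (hx : HasStdPart φ x a) (hy : HasStdPart φ y b) :
    HasStdPart φ (x - y) (a - b) := by
  rw [sub_eq_add_neg, sub_eq_add_neg]
  exact hx.add hy.neg

end RingStandardPart

end NonstandardExtension

namespace NonstandardAdele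

open NumberField NonstandardExtension Topology Filter IsDedekindDomain

section AdicCompletion

variable {R F : Type*} [CommRing R] [IsDedekindDomain R] [Field F] [Algebra R F]
  [IsFractionRing R F] (v : HeightOneSpectrum R)

theorem residue_adicCompletionIntegers_eq_zero_iff {x : v.adicCompletionIntegers F} :
    IsLocalRing.residue (v.adicCompletionIntegers F) x = 0 ↔
      Valued.v (x : v.adicCompletion F) < 1 := by
  rw [IsLocalRing.residue_eq_zero_iff, IsLocalRing.mem_maximalIdeal, mem_nonunits_iff,
    HeightOneSpectrum.adicCompletionIntegers.isUnit_iff_valued_eq_one]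
  exact ⟨x.2.lt_of_ne, ne_of_lt⟩

theorem exists_valued_algebraMap_sub_lt_one (x : v.adicCompletionIntegers F) :
    ∃ a : R, Valued.v (algebraMap R (v.adicCompletion F) a - x) < 1 := by
  have hball : {z : v.adicCompletion F | Valued.v (z - x) < 1} ∈ 𝓝 (x : v.adicCompletion F) :=
    Valued.mem_nhds.2 ⟨1, fun _ hz => by simpa using hz⟩
  obtain ⟨k, hk⟩ := (HeightOneSpectrum.denseRange_algebraMap F v).mem_nhds hball
  have hk_le : v.valuation F k ≤ 1 := by
    have hx : Valued.v (x : v.adicCompletion F) ≤ 1 := x.2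
    have hk_add := Valued.v.map_add_le hk.out.le hx
    rw [sub_add_cancel] at hk_add
    rwa [← HeightOneSpectrum.valuedAdicCompletion_eq_valuation']
  obtain ⟨a, ha⟩ := v.exists_valuation_sub_lt_of_integer hk_le 1
  have hak : Valued.v (algebraMap R (v.adicCompletion F) a - algebraMap F _ k) < 1 := by
    rw [IsScalarTower.algebraMap_apply R F, ← map_sub]
    rwa [← HeightOneSpectrum.valuedAdicCompletion_eq_valuation', Units.val_one] at ha
  refine ⟨a, ?_⟩
  rw [← sub_add_sub_cancel _ (algebraMap F (v.adicCompletion F) k)]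
  exact Valued.v.map_add_lt hak hk

theorem finite_residueField_adicCompletionIntegers [Finite (R ⧸ v.asIdeal)] :
    Finite (IsLocalRing.ResidueField (v.adicCompletionIntegers F)) := by
  let f : R →+* IsLocalRing.ResidueField (v.adicCompletionIntegers F) :=
    (IsLocalRing.residue _).comp (algebraMap R _)
  have hker (a : R) (ha : a ∈ v.asIdeal) : f a = 0 := by
    refine (residue_adicCompletionIntegers_eq_zero_iff v).2 ?_
    rw [HeightOneSpectrum.algebraMap_adicCompletionIntegers_apply,
      HeightOneSpectrum.valuedAdicCompletion_eq_valuation']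
    exact (v.valuation_lt_one_iff_mem a).2 ha
  have hsurj : Function.Surjective f := by
    intro y
    obtain ⟨x, rfl⟩ := IsLocalRing.residue_surjective y
    obtain ⟨a, ha⟩ := exists_valued_algebraMap_sub_lt_one v x
    refine ⟨a, sub_eq_zero.1 ?_⟩
    rw [RingHom.comp_apply, ← map_sub, residue_adicCompletionIntegers_eq_zero_iff]
    exact ha
  exact .of_surjective _ (Ideal.Quotient.lift_surjective_of_surjective v.asIdeal hker hsurj)

end AdicCompletion

variable {K : Type*} [Field K] [NumberField K]

theorem countable_finitePlace : Countable (FinitePlace K) := by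
  have hspan : Function.Surjective fun s : Finset (𝓞 K) => Ideal.span (s : Set (𝓞 K)) :=
    IsNoetherian.noetherian
  have : Countable K := Finsupp.Countable.of_moduleFinite (R := ℚ)
  have : Countable (𝓞 K) := RingOfIntegers.coe_injective.countable
  have : Countable (Ideal (𝓞 K)) := hspan.countable
  exact ((HeightOneSpectrum.asIdeal_injective (R := 𝓞 K)).comp
    FinitePlace.equivHeightOneSpectrum.injective).countable

theorem abv_isNontrivial (v : Place K) : v.abv.IsNontrivial := by
  rcases v with v | w
  · exact v.isNontrivial
  · obtain ⟨x, hx, hx0⟩ := Submodule.exists_mem_ne_zero_of_ne_bot w.maximalIdeal.ne_bot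
    refine ⟨x, by simpa using hx0, ne_of_lt ?_⟩
    change w x < 1
    rw [← FinitePlace.norm_embedding_eq]
    exact (FinitePlace.norm_lt_one_iff_mem K _ x).2 hx

theorem finitePlace_natCast_le_one (w : FinitePlace K) (n : ℕ) : w (n : K) ≤ 1 := by
  rw [← FinitePlace.norm_embedding_eq]
  simpa using FinitePlace.norm_le_one K w.maximalIdeal (n : 𝓞 K)

theorem infinitePlace_not_isEquiv_finitePlace (v : InfinitePlace K) (w : FinitePlace K) :
    ¬ v.1.IsEquiv w.1 := by
  intro h
  have h2 : v ((2 : ℕ) : K) ≤ 1 := h.le_one_iff.2 (finitePlace_natCast_le_one w 2)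
  rw [InfinitePlace.map_natCast] at h2
  norm_num at h2

theorem finitePlace_eq_of_isEquiv {v w : FinitePlace K} (h : v.1.IsEquiv w.1) : v = w := by
  rw [← FinitePlace.maximalIdeal_inj]
  ext x
  rw [← FinitePlace.norm_lt_one_iff_mem K, ← FinitePlace.norm_lt_one_iff_mem K,
    FinitePlace.norm_embedding_eq, FinitePlace.norm_embedding_eq]
  exact h.lt_one_iff

theorem abv_not_isEquiv {v w : Place K} (h : v ≠ w) : ¬ v.abv.IsEquiv w.abv := by
  rcases v with v | v <;> rcases w with w | w
  · exact fun h' => h (congrArg _ (InfinitePlace.eq_iff_isEquiv.2 h'))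
  · exact infinitePlace_not_isEquiv_finitePlace v w
  · exact fun h' => infinitePlace_not_isEquiv_finitePlace w v h'.symm
  · exact fun h' => h (congrArg _ (finitePlace_eq_of_isEquiv h'))

section Completion

instance properSpace_infinitePlace_completion (v : InfinitePlace K) : ProperSpace v.Completion where
  isCompact_closedBall x r := by
    have h := InfinitePlace.Completion.isometry_extensionEmbedding v
    rw [← h.preimage_closedBall]
    exact h.isClosedEmbedding.isCompact_preimage (isCompact_closedBall _ _)

instance properSpace_adicCompletion (w : HeightOneSpectrum (𝓞 K)) :
    ProperSpace (w.adicCompletion K) := by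
  have := w.asIdeal.finiteQuotientOfFreeOfNeBot w.ne_bot
  rw [Valued.integer.properSpace_iff_completeSpace_and_isDiscreteValuationRing_integer_and_finite_residueField]
  exact ⟨inferInstance, inferInstanceAs (IsDiscreteValuationRing (w.adicCompletionIntegers K)),
    finite_residueField_adicCompletionIntegers w⟩

/-- The completion `K_v` of `K` at a place `v`. For a finite place this is the adic completion at
the corresponding prime ideal, because the finite adeles are indexed by prime ideals. -/
def Place.Completion : Place K → Type _
  | .inl v => v.Completion
  | .inr w => w.maximalIdeal.adicCompletion K

noncomputable instance (v : Place K) : NormedField v.Completion :=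
  match v with
  | .inl v => inferInstanceAs (NormedField v.Completion)
  | .inr w => inferInstanceAs (NormedField (w.maximalIdeal.adicCompletion K))

instance : ∀ v : Place K, ProperSpace v.Completion
  | .inl v => inferInstanceAs (ProperSpace v.Completion)
  | .inr w => inferInstanceAs (ProperSpace (w.maximalIdeal.adicCompletion K))

/-- The embedding of `K` into its completion `K_v`. -/
noncomputable def Place.embedding : (v : Place K) → K →+* v.Completion
  | .inl v => algebraMap K v.Completion
  | .inr w => algebraMap K (w.maximalIdeal.adicCompletion K)

theorem Place.norm_embedding (v : Place K) (k : K) : ‖v.embedding k‖ = v.abv k := by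
  rcases v with v | w
  · exact InfinitePlace.Completion.norm_coe v _
  · exact w.norm_embedding_eq k

theorem Place.denseRange_embedding (v : Place K) : DenseRange v.embedding := by
  rcases v with v | w
  · exact (InfinitePlace.Completion.denseRange_coe v).comp
      (WithAbs.equiv v.1).symm.surjective.denseRange (InfinitePlace.Completion.continuous_coe v)
  · exact HeightOneSpectrum.denseRange_algebraMap K w.maximalIdeal

theorem Place.isometry_embedding (v : Place K) :
    Isometry fun x : WithAbs v.abv => v.embedding x.ofAbs :=
  AddMonoidHomClass.isometry_of_norm
    (v.embedding.comp (WithAbs.equiv v.abv).toRingHom) fun x => v.norm_embedding x.ofAbs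

theorem denseRange_embedding_pi : DenseRange fun (k : K) (v : Place K) => v.embedding k := by
  refine denseRange_pi_of_forall_finset fun s => ?_
  have hK : DenseRange (algebraMap K ((v : s) → WithAbs v.1.abv)) :=
    AbsoluteValue.denseRange_algebraMap_pi (fun v => abv_isNontrivial v.1)
      fun v w hvw => abv_not_isEquiv (Subtype.coe_injective.ne hvw)
  have hcompletion (v : s) : DenseRange fun x : WithAbs v.1.abv => v.1.embedding x.ofAbs :=
    .of_comp (g := (WithAbs.equiv v.1.abv).symm) v.1.denseRange_embedding
  have hcont : Continuous
      (Pi.map fun (v : s) (x : WithAbs v.1.abv) => v.1.embedding x.ofAbs) :=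
    .piMap fun v => v.1.isometry_embedding.continuous
  exact (DenseRange.piMap hcompletion).comp hK hcont

end Completion

section Adele

/-- The component `a_v ∈ K_v` of an adele `a` at a place `v`. -/
noncomputable def evalAt : (v : Place K) → AdeleRing (𝓞 K) K →+* v.Completion
  | .inl v => (Pi.evalRingHom _ v).comp (RingHom.fst _ _)
  | .inr w => (RestrictedProduct.evalRingHom _ w.maximalIdeal).comp (RingHom.snd _ _)

theorem maximalIdeal_surjective :
    Function.Surjective (FinitePlace.maximalIdeal : FinitePlace K → HeightOneSpectrum (𝓞 K)) :=
  fun P => ⟨.mk P, FinitePlace.maximalIdeal_mk P⟩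

theorem adele_ext {a b : AdeleRing (𝓞 K) K} (h : ∀ v, evalAt v a = evalAt v b) : a = b :=
  Prod.ext (funext fun v => h (.inl v))
    (FiniteAdeleRing.ext K (maximalIdeal_surjective.forall.2 fun w => h (.inr w)))

theorem continuous_evalAt (v : Place K) : Continuous (evalAt v) := by
  rcases v with v | w
  · exact (continuous_apply v).comp
      (continuous_fst (X := InfiniteAdeleRing K) (Y := FiniteAdeleRing (𝓞 K) K))
  · exact (RestrictedProduct.continuous_eval w.maximalIdeal).comp
      (continuous_snd (X := InfiniteAdeleRing K) (Y := FiniteAdeleRing (𝓞 K) K))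

theorem mem_adicCompletionIntegers_iff_norm_le_one {P : HeightOneSpectrum (𝓞 K)}
    {x : P.adicCompletion K} : x ∈ P.adicCompletionIntegers K ↔ ‖x‖ ≤ 1 := by
  have h : (P.adicCompletionIntegers K : Set (P.adicCompletion K)) = Metric.closedBall 0 1 :=
    Valued.toNormedField.setOfPred_mem_integer_eq_closedBall
  rw [← SetLike.mem_coe, h, mem_closedBall_zero_iff]

/-- The set `A_{K,T}` of adeles that are integral at all non-Archimedean places outside `T`. -/
def adelesIntegralOutside (T : Set (Place K)) : Set (AdeleRing (𝓞 K) K) :=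
  {a | ∀ v ∉ T ∪ Arch K, ‖evalAt v a‖ ≤ 1}

theorem inr_mem_union_arch_iff {T : Set (Place K)} {w : FinitePlace K} :
    .inr w ∈ T ∪ Arch K ↔ .inr w ∈ T := by
  simp [Arch]

theorem mem_adelesIntegralOutside {T : Set (Place K)} {a : AdeleRing (𝓞 K) K} :
    a ∈ adelesIntegralOutside T ↔ ∀ P : HeightOneSpectrum (𝓞 K),
      P ∉ FinitePlace.maximalIdeal '' (Sum.inr ⁻¹' T) → a.2 P ∈ P.adicCompletionIntegers K := by
  rw [maximalIdeal_surjective.forall]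
  simp only [adelesIntegralOutside, Set.mem_ofPred_eq, Sum.forall, inr_mem_union_arch_iff,
    FinitePlace.maximalIdeal_injective.mem_set_image, Set.mem_preimage,
    mem_adicCompletionIntegers_iff_norm_le_one]
  exact and_iff_right fun v hv => absurd (Or.inr ⟨v, rfl⟩) hv

theorem isOpen_adelesIntegralOutside (T : Set (Place K)) : IsOpen (adelesIntegralOutside T) := by
  have h : IsOpen {b : FiniteAdeleRing (𝓞 K) K | ∀ P : HeightOneSpectrum (𝓞 K),
      P ∉ FinitePlace.maximalIdeal '' (Sum.inr ⁻¹' T) → b P ∈ P.adicCompletionIntegers K} :=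
    RestrictedProduct.isOpen_forall_imp_mem
      (fun P : HeightOneSpectrum (𝓞 K) => Valued.isOpen_valuationSubring (P.adicCompletion K))
  rw [show adelesIntegralOutside T = _ from Set.ext fun _ => mem_adelesIntegralOutside]
  exact h.preimage (continuous_snd (X := InfiniteAdeleRing K))

theorem exists_mem_adelesIntegralOutside (a : AdeleRing (𝓞 K) K) :
    ∃ T : Finset (Place K), a ∈ adelesIntegralOutside (T : Set (Place K)) := by
  have hT : {P : HeightOneSpectrum (𝓞 K) | a.2 P ∉ P.adicCompletionIntegers K}.Finite := a.2.2
  have hT' := (hT.preimage FinitePlace.maximalIdeal_injective.injOn).image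
    (Sum.inr : FinitePlace K → Place K)
  refine ⟨hT'.toFinset, mem_adelesIntegralOutside.2 ?_⟩
  refine maximalIdeal_surjective.forall.2 fun w hw => ?_
  by_contra h
  exact hw ⟨w, by simpa using h, rfl⟩

theorem exists_forall_evalAt_eq {T : Set (Place K)} (hT : T.Finite)
    {x : (v : Place K) → v.Completion} (hx : ∀ v ∉ T ∪ Arch K, ‖x v‖ ≤ 1) :
    ∃ a : AdeleRing (𝓞 K) K, ∀ v, evalAt v a = x v := by
  let b : (P : HeightOneSpectrum (𝓞 K)) → P.adicCompletion K :=
    Equiv.piCongrLeft (fun P : HeightOneSpectrum (𝓞 K) => P.adicCompletion K)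
      FinitePlace.equivHeightOneSpectrum fun w => x (.inr w)
  have hb (w : FinitePlace K) : b w.maximalIdeal = x (.inr w) :=
    Equiv.piCongrLeft_apply_apply _ FinitePlace.equivHeightOneSpectrum _ w
  have hfin : {P | b P ∉ P.adicCompletionIntegers K}.Finite := by
    refine ((hT.preimage Sum.inr_injective.injOn).image FinitePlace.maximalIdeal).subset ?_
    refine maximalIdeal_surjective.forall.2 fun w hw => ⟨w, ?_, rfl⟩
    by_contra h
    refine hw (mem_adicCompletionIntegers_iff_norm_le_one.2 ?_)
    rw [hb]
    exact hx _ (inr_mem_union_arch_iff.not.2 h)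
  exact ⟨(fun v => x (.inl v), ⟨b, hfin⟩), Sum.rec (fun _ => rfl) hb⟩

theorem continuous_of_continuous_evalAt {Y : Type*} [TopologicalSpace Y] {T : Set (Place K)}
    (hT : T.Finite) {f : Y → AdeleRing (𝓞 K) K} (hfT : ∀ y, f y ∈ adelesIntegralOutside T)
    (hf : ∀ v, Continuous fun y => evalAt v (f y)) : Continuous f := by
  let T' : Set (HeightOneSpectrum (𝓞 K)) := (FinitePlace.maximalIdeal '' (Sum.inr ⁻¹' T))ᶜ
  have hT' : cofinite ≤ 𝓟 T' := le_principal_iff.2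
    ((hT.preimage Sum.inr_injective.injOn).image FinitePlace.maximalIdeal).compl_mem_cofinite
  let g : Y → RestrictedProduct (fun P : HeightOneSpectrum (𝓞 K) => P.adicCompletion K)
      (fun P => (P.adicCompletionIntegers K : Set (P.adicCompletion K))) (𝓟 T') :=
    fun y => ⟨(f y).2, eventually_principal.2 (mem_adelesIntegralOutside.1 (hfT y))⟩
  have hg : Continuous g := RestrictedProduct.continuous_rng_of_principal_iff_forall.2
    (maximalIdeal_surjective.forall.2 fun w => hf (.inr w))
  have hinf : Continuous fun y => (f y).1 := continuous_pi fun v => hf (.inl v)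
  exact (hinf.prodMk ((RestrictedProduct.continuous_inclusion hT').comp hg) :)

instance locallyCompactSpace_finiteAdeleRing : LocallyCompactSpace (FiniteAdeleRing (𝓞 K) K) := by
  have : Fact (∀ P : HeightOneSpectrum (𝓞 K),
      IsOpen (P.adicCompletionIntegers K : Set (P.adicCompletion K))) :=
    ⟨fun _ => Valued.isOpen_valuationSubring _⟩
  refine RestrictedProduct.locallyCompactSpace_of_addGroup
    (fun P : HeightOneSpectrum (𝓞 K) => P.adicCompletion K) (.of_forall fun P => ?_)
  convert isCompact_closedBall (0 : P.adicCompletion K) 1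
  ext x
  rw [mem_closedBall_zero_iff]
  exact mem_adicCompletionIntegers_iff_norm_le_one

instance locallyCompactSpace_adeleRing : LocallyCompactSpace (AdeleRing (𝓞 K) K) :=
  inferInstanceAs (LocallyCompactSpace (InfiniteAdeleRing K × FiniteAdeleRing (𝓞 K) K))

instance t2Space_adeleRing : T2Space (AdeleRing (𝓞 K) K) :=
  .of_injective_continuous (f := fun a v => evalAt v a)
    (fun _ _ h => adele_ext fun v => congrFun h v) (continuous_pi continuous_evalAt)

end Adele

variable {S : Type u} {E : NonstandardExtension.{u, w} S} {iK : K ↪ S} {iR : ℝ ↪ S}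

section StandardPart

variable {v : Place K} {x : E.Star iK} {a : v.Completion} {r : ℝ}

theorem starAbv_lt_iff_eventually :
    starAbv E iK iR v x < E.embed iR r ↔ ∀ᶠ k in pointUltrafilter x, v.abv k < r := by
  have h := starAbv_starFun_lt (iR := iR) v (fun p : Fin 1 → K => p 0) (fun _ => x) r
  rwa [starFun_proj] at h

theorem starAbv_le_iff_eventually :
    starAbv E iK iR v x ≤ E.embed iR r ↔ ∀ᶠ k in pointUltrafilter x, v.abv k ≤ r := by
  have h := starAbv_starFun_le (iR := iR) v (fun p : Fin 1 → K => p 0) (fun _ => x) r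
  rwa [starFun_proj] at h

theorem starAbv_lt_of_hasStdPart (hx : HasStdPart v.embedding x a) (ha : ‖a‖ < r) :
    starAbv E iK iR v x < E.embed iR r := by
  rw [starAbv_lt_iff_eventually]
  filter_upwards [(Tendsto.norm hx).eventually_lt_const ha] with k hk
  rwa [← v.norm_embedding]

theorem norm_le_of_starAbv_le (hx : HasStdPart v.embedding x a)
    (h : starAbv E iK iR v x ≤ E.embed iR r) : ‖a‖ ≤ r := by
  refine le_of_tendsto (Tendsto.norm hx) ((starAbv_le_iff_eventually.1 h).mono fun k hk => ?_)
  rwa [v.norm_embedding]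

theorem norm_le_of_starAbv_lt (hx : HasStdPart v.embedding x a)
    (h : starAbv E iK iR v x < E.embed iR r) : ‖a‖ ≤ r :=
  norm_le_of_starAbv_le (iR := iR) hx
    (starAbv_le_iff_eventually.2 ((starAbv_lt_iff_eventually.1 h).mono fun _ => le_of_lt))

theorem isOpen_setOf_norm_le_one (hv : v ∉ Arch K) : IsOpen {b : v.Completion | ‖b‖ ≤ 1} := by
  rcases v with v | w
  · exact absurd ⟨v, rfl⟩ hv
  · have hball : {b : w.maximalIdeal.adicCompletion K | ‖b‖ ≤ 1} =
        w.maximalIdeal.adicCompletionIntegers K :=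
      Set.ext fun _ => mem_adicCompletionIntegers_iff_norm_le_one.symm
    exact hball ▸ Valued.isOpen_valuationSubring (w.maximalIdeal.adicCompletion K)

theorem starAbv_le_one_iff (hv : v ∉ Arch K) (hx : HasStdPart v.embedding x a) :
    starAbv E iK iR v x ≤ 1 ↔ ‖a‖ ≤ 1 := by
  refine ⟨norm_le_of_starAbv_le hx, fun ha => starAbv_le_iff_eventually.2 ?_⟩
  filter_upwards [hx ((isOpen_setOf_norm_le_one hv).mem_nhds ha)] with k (hk : ‖_‖ ≤ 1)
  rwa [← v.norm_embedding]

theorem exists_hasStdPart_iff :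
    (∃ a, HasStdPart v.embedding x a) ↔ ∃ r, starAbv E iK iR v x < E.embed iR r := by
  constructor
  · exact fun ⟨a, ha⟩ => ⟨‖a‖ + 1, starAbv_lt_of_hasStdPart ha (lt_add_one _)⟩
  · rintro ⟨r, hr⟩
    refine exists_hasStdPart_of_eventually_mem (isCompact_closedBall 0 r) ?_
    filter_upwards [starAbv_lt_iff_eventually.1 hr] with k hk
    rw [mem_closedBall_zero_iff, v.norm_embedding]
    exact hk.le

theorem hasStdPart_zero_iff : HasStdPart v.embedding x 0 ↔
    ∀ ε : ℝ, 0 < ε → starAbv E iK iR v x < E.embed iR ε := by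
  simp only [HasStdPart, Metric.tendsto_nhds, dist_zero_right, v.norm_embedding,
    starAbv_lt_iff_eventually, gt_iff_lt]

theorem mem_finVS_iff_of_hasStdPart {T : Finset (Place K)} {st : (v : Place K) → v.Completion}
    (hx : ∀ v, HasStdPart v.embedding x (st v)) :
    x ∈ finVS E iK iR T ↔ ∀ v ∉ (T : Set (Place K)) ∪ Arch K, ‖st v‖ ≤ 1 := by
  have hfin : x ∈ finV E iK iR := fun v => exists_hasStdPart_iff.1 ⟨_, hx v⟩
  refine (and_iff_right hfin).trans (forall₂_congr fun v hv => ?_)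
  exact starAbv_le_one_iff (fun h => hv (Or.inr h)) (hx v)

end StandardPart

section Topology

theorem nhds_star (x : E.Star iK) :
    @nhds _ (starUniformSpace E iK iR).toTopologicalSpace x = ⨅ (v : Place K) (ε : ℝ) (_ : 0 < ε),
      𝓟 {y | starAbv E iK iR v (x - y) < E.embed iR ε} := by
  let := starUniformSpace E iK iR
  rw [nhds_eq_comap_uniformity]
  change comap _ (⨅ (v : Place K) (ε : ℝ) (_ : 0 < ε),
    𝓟 {z : E.Star iK × E.Star iK | starAbv E iK iR v (z.1 - z.2) < E.embed iR ε}) = _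
  simp only [comap_iInf, comap_principal]
  rfl

theorem iInf_principal_starAbv_sub_lt {Y : Type*} {v : Place K} {g : Y → E.Star iK}
    {st : Y → v.Completion} (hst : ∀ y, HasStdPart v.embedding (g y) (st y)) (y : Y) :
    ⨅ (ε : ℝ) (_ : 0 < ε), 𝓟 {z | starAbv E iK iR v (g y - g z) < E.embed iR ε} =
      comap st (𝓝 (st y)) := by
  have hsub (z : Y) : HasStdPart v.embedding (g y - g z) (st y - st z) := (hst y).sub (hst z)
  rw [(Metric.nhds_basis_ball.comap st).eq_biInf]
  refine le_antisymm (le_iInf₂ fun ε hε => ?_) (iInf₂_mono fun ε _ => principal_mono.2 ?_)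
  · refine iInf₂_le_of_le (ε / 2) (half_pos hε) (principal_mono.2 fun z hz => ?_)
    have hz' : ‖st y - st z‖ ≤ ε / 2 := norm_le_of_starAbv_lt (hsub z) hz
    rw [Set.mem_preimage, Metric.mem_ball', dist_eq_norm]
    exact hz'.trans_lt (half_lt_self hε)
  · intro z hz
    rw [Set.mem_preimage, Metric.mem_ball', dist_eq_norm] at hz
    exact starAbv_lt_of_hasStdPart (hsub z) hz

theorem isInducing_of_hasStdPart {Y : Type*} [tY : TopologicalSpace Y] {g : Y → E.Star iK}
    (hY : tY = (starUniformSpace E iK iR).toTopologicalSpace.induced g)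
    {st : Y → (v : Place K) → v.Completion}
    (hst : ∀ y v, HasStdPart v.embedding (g y) (st y v)) : IsInducing st := by
  refine isInducing_iff_nhds.2 fun y => ?_
  subst hY
  rw [@nhds_induced _ _ (starUniformSpace E iK iR).toTopologicalSpace, nhds_star, nhds_pi,
    Filter.pi, comap_iInf, comap_iInf]
  refine iInf_congr fun v => ?_
  rw [comap_comap]
  refine Eq.trans ?_ (iInf_principal_starAbv_sub_lt (iR := iR) (fun y => hst y v) y)
  simp only [comap_iInf, comap_principal, Set.preimage_ofPred_eq]

end Topology

section StandardAdele

theorem exists_adele_hasStdPart (x : finV' E iK iR) :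
    ∃ a : AdeleRing (𝓞 K) K, ∀ v, HasStdPart v.embedding (x : E.Star iK) (evalAt v a) := by
  obtain ⟨T, hT⟩ := mem_finV'.1 x.2
  choose st hst using fun v => exists_hasStdPart_iff.2 (hT.1 v)
  obtain ⟨a, ha⟩ := exists_forall_evalAt_eq T.finite_toSet ((mem_finVS_iff_of_hasStdPart hst).1 hT)
  exact ⟨a, fun v => ha v ▸ hst v⟩

theorem adele_eq_of_hasStdPart {x : E.Star iK} {a b : AdeleRing (𝓞 K) K}
    (ha : ∀ v, HasStdPart v.embedding x (evalAt v a))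
    (hb : ∀ v, HasStdPart v.embedding x (evalAt v b)) : a = b :=
  adele_ext fun v => (ha v).unique (hb v)

/-- The homomorphism `Φ` which takes standard parts at all places. -/
noncomputable def stdAdele : finV' E iK iR →+* AdeleRing (𝓞 K) K :=
  have h (x : finV' E iK iR) := (exists_adele_hasStdPart x).choose_spec
  { toFun := fun x => (exists_adele_hasStdPart x).choose
    map_one' := adele_eq_of_hasStdPart (h 1) fun v => by
      rw [map_one, ← map_one v.embedding]
      exact hasStdPart_embed v.embedding 1
    map_zero' := adele_eq_of_hasStdPart (h 0) fun v => by
      rw [map_zero, ← map_zero v.embedding]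
      exact hasStdPart_embed v.embedding 0
    map_add' := fun x y => adele_eq_of_hasStdPart (h (x + y)) fun v =>
      map_add (evalAt v) _ _ ▸ (h x v).add (h y v)
    map_mul' := fun x y => adele_eq_of_hasStdPart (h (x * y)) fun v =>
      map_mul (evalAt v) _ _ ▸ (h x v).mul (h y v) }

theorem hasStdPart_stdAdele (x : finV' E iK iR) (v : Place K) :
    HasStdPart v.embedding (x : E.Star iK) (evalAt v (stdAdele x)) :=
  (exists_adele_hasStdPart x).choose_spec v

theorem stdAdele_eq_of_hasStdPart {x : finV' E iK iR} {a : AdeleRing (𝓞 K) K}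
    (h : ∀ v, HasStdPart v.embedding (x : E.Star iK) (evalAt v a)) : stdAdele x = a :=
  adele_eq_of_hasStdPart (hasStdPart_stdAdele x) h

theorem ker_stdAdele : RingHom.ker (stdAdele (E := E) (iK := iK) (iR := iR)) = infV E iK iR := by
  ext x
  have hzero : stdAdele x = 0 ↔ ∀ v : Place K, HasStdPart v.embedding (x : E.Star iK) 0 := by
    refine ⟨fun h v => ?_, fun h => stdAdele_eq_of_hasStdPart fun v => ?_⟩
    · simpa only [h, map_zero] using hasStdPart_stdAdele x v
    · rw [map_zero]
      exact h v
  exact hzero.trans (forall_congr' fun v => hasStdPart_zero_iff)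

theorem isStandardPart_stdAdele (x : finV' E iK iR) :
    IsStandardPart E iK iR (x : E.Star iK) (stdAdele x) := by
  have h (v : Place K) (k : K) (ε : ℝ) (hε : ‖evalAt v (stdAdele x) - v.embedding k‖ < ε) :
      starAbv E iK iR v (x - E.embed iK k) < E.embed iR ε :=
    starAbv_lt_of_hasStdPart ((hasStdPart_stdAdele x v).sub (hasStdPart_embed v.embedding k)) hε
  refine ⟨fun v => h (.inl v), maximalIdeal_surjective.forall.2 fun w => ?_⟩
  rw [FinitePlace.mk_maximalIdeal]
  exact h (.inr w)

theorem exists_forall_hasStdPart (st : (v : Place K) → v.Completion) :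
    ∃ x : E.Star iK, ∀ v, HasStdPart v.embedding x (st v) := by
  have : Countable (FinitePlace K) := countable_finitePlace
  have : (comap (fun (k : K) (v : Place K) => v.embedding k) (𝓝 st)).NeBot :=
    comap_neBot fun _ ht => denseRange_embedding_pi.mem_nhds ht
  obtain ⟨x, hx⟩ := exists_pointUltrafilter_le (E := E) (i := iK)
    (comap (fun (k : K) (v : Place K) => v.embedding k) (𝓝 st))
  exact ⟨x, tendsto_pi_nhds.1 (tendsto_iff_comap.2 hx)⟩

theorem stdAdele_surjective : Function.Surjective (stdAdele (E := E) (iK := iK) (iR := iR)) := by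
  intro a
  obtain ⟨x, hx⟩ := exists_forall_hasStdPart (E := E) (iK := iK) fun v => evalAt v a
  obtain ⟨T, hT⟩ := exists_mem_adelesIntegralOutside a
  have hxT : x ∈ finVS E iK iR T := (mem_finVS_iff_of_hasStdPart hx).2 hT
  exact ⟨⟨x, mem_finV'.2 ⟨T, hxT⟩⟩, stdAdele_eq_of_hasStdPart hx⟩

theorem range_inclusion_finVS (T : Finset (Place K)) :
    Set.range (Subring.inclusion (le_iSup (finVS E iK iR) T)) =
      stdAdele ⁻¹' adelesIntegralOutside (T : Set (Place K)) := by
  refine (Set.range_inclusion (le_iSup (finVS E iK iR) T)).trans (Set.ext fun x => ?_)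
  exact mem_finVS_iff_of_hasStdPart (hasStdPart_stdAdele x)

theorem isInducing_stdAdele_comp_inclusion (T : Finset (Place K)) :
    IsInducing (stdAdele ∘ Subring.inclusion (le_iSup (finVS E iK iR) T)) := by
  have hst : IsInducing fun (x : finVS E iK iR T) (v : Place K) =>
      evalAt v (stdAdele (Subring.inclusion (le_iSup (finVS E iK iR) T) x)) :=
    isInducing_of_hasStdPart rfl fun x v => hasStdPart_stdAdele (Subring.inclusion _ x) v
  refine .of_comp ?_ (continuous_pi continuous_evalAt) hst
  exact continuous_of_continuous_evalAt T.finite_toSet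
    (fun x => (range_inclusion_finVS T).le ⟨x, rfl⟩) (continuous_pi_iff.1 hst.continuous)

theorem isInducing_stdAdele : IsInducing (stdAdele (E := E) (iK := iK) (iR := iR)) :=
  isInducing_of_iSup_coinduced rfl
    (fun T : Finset (Place K) => isOpen_adelesIntegralOutside (T : Set (Place K)))
    range_inclusion_finVS (fun x => exists_mem_adelesIntegralOutside (stdAdele x))
    isInducing_stdAdele_comp_inclusion

end StandardAdele

end NonstandardAdele

theorem mainTheorem8 {K : Type*} [Field K] [NumberField K] {S : Type u}
    (E : NonstandardExtension.{u, w} S) (iK : K ↪ S) (iR : ℝ ↪ S) :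
    LocallyCompactSpace (finV' E iK iR) ∧
    ∃ _ : IsTopologicalRing (finV' E iK iR),
    (infV E iK iR : Set (finV' E iK iR)) = closure {0} ∧
    ∃ Φ : finV' E iK iR →+* AdeleRing (𝓞 K) K,
      Continuous Φ ∧ Function.Surjective Φ ∧ RingHom.ker Φ = infV E iK iR ∧
      (∀ x : finV' E iK iR, IsStandardPart E iK iR (x : E.Star iK) (Φ x)) ∧
      (∃ e : (finV' E iK iR ⧸ infV E iK iR) ≃+* AdeleRing (𝓞 K) K,
        IsHomeomorph e ∧ ∀ x, e (Ideal.Quotient.mk (infV E iK iR) x) = Φ x) ∧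
      (∃ e : SeparationQuotient (finV' E iK iR) ≃+* AdeleRing (𝓞 K) K,
        IsHomeomorph e ∧ ∀ x, e (SeparationQuotient.mk x) = Φ x) := by
  have hi := isInducing_stdAdele (E := E) (iK := iK) (iR := iR)
  have hs := stdAdele_surjective (E := E) (iK := iK) (iR := iR)
  have hker := ker_stdAdele (E := E) (iK := iK) (iR := iR)
  have hcl := closure_zero_eq_ker_of_isInducing hi
  have hq := hi.isQuotientMap_of_surjective hs
  have hring : IsTopologicalRing (finV' E iK iR) := isTopologicalRing_of_isInducing hi
  exact ⟨hi.locallyCompactSpace (by rw [hs.range_eq]; exact isOpen_univ.isLocallyClosed), hring,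
    by rw [hcl, hker], stdAdele, hi.continuous, hs, hker, isStandardPart_stdAdele,
    exists_quotient_ringEquiv_isHomeomorph hq hker,
    exists_separationQuotient_ringEquiv_isHomeomorph hq hcl.symm⟩
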